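/- Theorem A.4 (thm:PushOffSurface). Let $n\ge 0$, let $M$ be a compact topological $n$-manifold with (possibly empty) boundary $\partial M$, let $A$ be a topological space of covering dimension at most $n-1$ (that is, every finite open cover of $A$ has a finite open refinement such that each point of $A$ lies in at most $n$ of its members), let $f\colon A\to M$ be a topological embedding, and let $T$ be a countable subset of the interior $M\setminus\partial M$. Then there exists a topological embedding $g\colon A\to M$ such that $g(A)\cap T=\emptyset$, $g^{-1}(\partial M)=f^{-1}(\partial M)$, and $g(a)=f(a)$ for every $a\in f^{-1}(\partial M)$. -/

import Mathlib

open Topology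

/-- `X` has Lebesgue covering dimension at most `d` (with `d ≥ -1`): every finite open cover of `X`
has a finite open refinement of order at most `d`, that is, one for which every point of `X` lies in
at most `d + 1` members. In particular `d = -1` characterizes the empty space. -/
def CoveringDimLE (X : Type*) [TopologicalSpace X] (d : ℤ) : Prop :=
  -1 ≤ d ∧
  ∀ 𝒰 : Set (Set X), 𝒰.Finite → (∀ U ∈ 𝒰, IsOpen U) → ⋃₀ 𝒰 = Set.univ →
    ∃ 𝒱 : Set (Set X), 𝒱.Finite ∧ (∀ V ∈ 𝒱, IsOpen V) ∧ ⋃₀ 𝒱 = Set.univ ∧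
      (∀ V ∈ 𝒱, ∃ U ∈ 𝒰, V ⊆ U) ∧
      ∀ x : X, (({V ∈ 𝒱 | x ∈ V}.ncard : ℕ) : ℤ) ≤ d + 1

/-- The closed half-space of `ℝⁿ` where the first coordinate is nonnegative.
For `n = 0` there is no first coordinate and this is the point `ℝ⁰`. -/
def ClosedHalfSpace (n : ℕ) : Type :=
  {x : EuclideanSpace ℝ (Fin n) // ∀ i : Fin n, (i : ℕ) = 0 → 0 ≤ x i}

instance (n : ℕ) : TopologicalSpace (ClosedHalfSpace n) :=
  inferInstanceAs (TopologicalSpace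
    {x : EuclideanSpace ℝ (Fin n) // ∀ i : Fin n, (i : ℕ) = 0 → 0 ≤ x i})

/-- `M` is a topological `n`-manifold with (possibly empty) boundary: a second countable Hausdorff
space in which every point has an open neighbourhood homeomorphic to an open subset of the closed
half-space of `ℝⁿ`. -/
structure IsTopManifoldWithBoundary (n : ℕ) (M : Type*) [TopologicalSpace M] : Prop where
  t2 : T2Space M
  secondCountable : SecondCountableTopology M
  exists_chart : ∀ x : M, ∃ e : OpenPartialHomeomorph M (ClosedHalfSpace n), x ∈ e.source

/-- The interior of an `n`-manifold `M` with boundary: the set of the points that have an open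
neighbourhood homeomorphic to an open subset of `ℝⁿ`. -/
def manifoldInterior (n : ℕ) (M : Type*) [TopologicalSpace M] : Set M :=
  {x | ∃ e : OpenPartialHomeomorph M (EuclideanSpace ℝ (Fin n)), x ∈ e.source}

/-- The boundary of an `n`-manifold `M` with boundary: the set of the points that are not in its
interior. -/
def manifoldBoundary (n : ℕ) (M : Type*) [TopologicalSpace M] : Set M :=
  (manifoldInterior n M)ᶜ

/-! It is the points of `T` that are moved, not the embedding: `g = h.symm ∘ f` for a
self-homeomorphism `h` of `M` that carries `T` off the image of `f` and fixes every boundary point.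

A single interior point can be moved off by an arbitrarily small amount, because the image of `f`
contains no coordinate ball. Otherwise `A` would contain a closed copy of the `n`-ball, against the
Lebesgue covering theorem `not_coveringDimLE_closedBall`. That theorem is reduced to the
no-retraction theorem: a ball of too small covering dimension would have a smooth approximation of
its identity with null image, and such a map, translated so as to miss the origin, would yield a
`C¹` retraction onto the sphere. A volume computation excludes the retraction.

For countably many points, `exists_homeomorph_forall_notMem` composes such moves. Each one fixes the
points already placed and is so small that both the compositions and their inverses converge
uniformly. -/

/-! ### The no-retraction theorem, by a volume argument. -/

/-- A Lipschitz perturbation of the identity with constant less than one is a homeomorphism. -/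
theorem exists_homeomorph_id_add {E : Type*} [NormedAddCommGroup E] [CompleteSpace E]
    {u : E → E} {K : NNReal} (hK : K < 1) (hu : LipschitzWith K u) :
    ∃ h : E ≃ₜ E, ∀ x, h x = x + u x := by
  have hanti : AntilipschitzWith (1⁻¹ - K)⁻¹ fun x => id x + u x :=
    AntilipschitzWith.id.add_lipschitzWith hu (by simpa using hK)
  have hsurj : Function.Surjective fun x => id x + u x := by
    intro y
    have hc : ContractingWith K fun x => y - u x := by
      refine ⟨hK, LipschitzWith.of_dist_le_mul fun a b => ?_⟩
      rw [dist_sub_left]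
      exact hu.dist_le_mul a b
    have hfix := hc.fixedPoint_isFixedPt
    refine ⟨hc.fixedPoint, ?_⟩
    have : y - u hc.fixedPoint = hc.fixedPoint := hfix
    simp only [id]
    nth_rewrite 1 [← this]
    abel
  have hcont : UniformContinuous fun x => id x + u x :=
    uniformContinuous_id.add hu.uniformContinuous
  exact ⟨(Equiv.ofBijective _ ⟨hanti.injective, hsurj⟩).toHomeomorphOfIsInducing
    (hanti.isUniformInducing hcont).isInducing, fun x => rfl⟩

/-- `t ↦ det (1 + t A)` is a polynomial of degree at most the dimension, hence is recovered by
Lagrange interpolation. -/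
theorem det_one_add_smul_eq_sum_lagrange {E : Type*} [NormedAddCommGroup E] [NormedSpace ℝ E]
    [FiniteDimensional ℝ E] {s : Finset ℕ} {v : ℕ → ℝ} (hv : Set.InjOn v s)
    (hs : Module.finrank ℝ E < s.card) (A : E →L[ℝ] E) (t : ℝ) :
    (1 + t • A).det = ∑ i ∈ s, (1 + v i • A).det * (Lagrange.basis s v i).eval t := by
  classical
  let b := Module.finBasis ℝ E
  let B := LinearMap.toMatrix b b (A : E →ₗ[ℝ] E)
  let p : Polynomial ℝ :=
    ((Polynomial.X : Polynomial ℝ) • B.map Polynomial.C + (1 : Matrix _ _ ℝ).map Polynomial.C).det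
  have heval : ∀ r : ℝ, p.eval r = (1 + r • A).det := by
    intro r
    have h1 : (1 + r • A).det = (1 + r • B).det := by
      rw [ContinuousLinearMap.det, ← LinearMap.det_toMatrix b]
      congr 1
      simp [B, LinearMap.toMatrix_one]
    rw [h1, ← Polynomial.coe_evalRingHom, RingHom.map_det]
    congr 1
    ext i j
    by_cases hij : i = j <;> simp [hij] <;> ring
  have hdeg : p.degree < s.card := by
    refine lt_of_le_of_lt Polynomial.degree_le_natDegree ?_
    have := Polynomial.natDegree_det_X_add_C_le B 1
    rw [Fintype.card_fin] at this
    exact_mod_cast this.trans_lt hs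
  have h := Lagrange.eq_interpolate hv hdeg
  rw [← heval t, h, Lagrange.interpolate_apply, Polynomial.eval_finsetSum]
  refine Finset.sum_congr rfl fun i _ => ?_
  rw [Polynomial.eval_mul, Polynomial.eval_C, heval]

/-- A map on the unit ball that is Lipschitz and vanishes on the sphere stays Lipschitz when it
is extended by zero. -/
theorem lipschitzWith_indicator_closedBall {E F : Type*} [NormedAddCommGroup E] [NormedSpace ℝ E]
    [NormedAddCommGroup F] {g : E → F} {K : NNReal}
    (hg : LipschitzOnWith K g (Metric.closedBall 0 1)) (h0 : ∀ x, ‖x‖ = 1 → g x = 0) :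
    LipschitzWith K ((Metric.closedBall (0 : E) 1).indicator g) := by
  have key : ∀ x y : E, ‖x‖ ≤ 1 → 1 < ‖y‖ → dist (g x) 0 ≤ K * dist x y := by
    intro x y hx hy
    -- The segment from `x` to `y` meets the sphere, where `g` vanishes, at a point no farther from
    -- `x` than `y` is.
    have hc : ContinuousOn (fun t : ℝ => ‖AffineMap.lineMap x y t‖) (Set.Icc (0 : ℝ) 1) := by
      apply Continuous.continuousOn
      exact (AffineMap.lineMap_continuous).norm
    obtain ⟨t, ht, hzt⟩ := intermediate_value_Icc zero_le_one hc (show (1 : ℝ) ∈ Set.Icc _ _ by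
      simpa using ⟨hx, hy.le⟩)
    have hz : ‖AffineMap.lineMap x y t‖ = 1 := hzt
    rw [← h0 _ hz]
    refine (hg.dist_le_mul x (by simpa using hx) _ (by simp [hz])).trans ?_
    rw [dist_left_lineMap, Real.norm_of_nonneg ht.1]
    gcongr
    exact mul_le_of_le_one_left dist_nonneg ht.2
  refine LipschitzWith.of_dist_le_mul fun x y => ?_
  by_cases hx : x ∈ Metric.closedBall (0 : E) 1 <;> by_cases hy : y ∈ Metric.closedBall (0 : E) 1
  · simpa [Set.indicator_of_mem, hx, hy] using hg.dist_le_mul x hx y hy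
  · rw [Set.indicator_of_mem hx, Set.indicator_of_notMem hy]
    exact key x y (by simpa using hx) (by simpa using hy)
  · rw [Set.indicator_of_mem hy, Set.indicator_of_notMem hx, dist_comm, dist_comm x]
    exact key y x (by simpa using hy) (by simpa using hx)
  · rw [Set.indicator_of_notMem hx, Set.indicator_of_notMem hy, dist_self]
    positivity

open MeasureTheory in
/-- There is no `C¹` retraction of the closed unit ball onto the unit sphere. -/
theorem not_exists_contDiff_retraction {E : Type*} [NormedAddCommGroup E] [InnerProductSpace ℝ E]
    [FiniteDimensional ℝ E] {r : E → E}
    (hr : ∀ x ∈ Metric.closedBall (0 : E) 1, ContDiffAt ℝ 1 r x)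
    (hnorm : ∀ x ∈ Metric.closedBall (0 : E) 1, ‖r x‖ = 1)
    (hfix : ∀ x, ‖x‖ = 1 → r x = x) : False := by
  borelize E
  set B := Metric.closedBall (0 : E) 1 with hB
  have hBc : IsCompact B := isCompact_closedBall 0 1
  set A : E → E →L[ℝ] E := fun x => fderiv ℝ r x - 1 with hA
  have hrd : ∀ x ∈ B, HasFDerivAt r (fderiv ℝ r x) x := fun x hx =>
    ((hr x hx).differentiableAt (by norm_num)).hasFDerivAt
  have hAc : ContinuousOn A B := fun x hx =>
    ((((hr x hx).fderiv_right (m := 0) (by norm_num)).continuousAt.sub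
      continuousAt_const)).continuousWithinAt
  obtain ⟨C, hC⟩ := hBc.exists_bound_of_continuousOn hAc
  set K : NNReal := C.toNNReal
  have hAK : ∀ x ∈ B, ‖A x‖ ≤ K := fun x hx => (hC x hx).trans (Real.le_coe_toNNReal C)
  have hgd : ∀ x ∈ B, HasFDerivAt (fun x => r x - x) (A x) x := fun x hx =>
    (hrd x hx).sub (hasFDerivAt_id x)
  have hgL : LipschitzOnWith K (fun x => r x - x) B :=
    Convex.lipschitzOnWith_of_nnnorm_hasFDerivWithin_le
      (fun x hx => (hgd x hx).hasFDerivWithinAt) (fun x hx => by exact_mod_cast hAK x hx)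
      (convex_closedBall 0 1)
  have hgL' := lipschitzWith_indicator_closedBall hgL (fun x hx => by simp [hfix x hx])
  set u := B.indicator fun x => r x - x with hu
  -- for small times the flow preserves the volume of the ball
  have hdet : ∃ δ > 0, ∀ L : E →L[ℝ] E, ‖L‖ < δ → 0 < (1 + L).det := by
    have hcont : ContinuousAt (fun L : E →L[ℝ] E => (1 + L).det) 0 :=
      (ContinuousLinearMap.continuous_det.comp (continuous_const.add continuous_id)).continuousAt
    have h1 : (0 : ℝ) < (1 + (0 : E →L[ℝ] E)).det := by
      rw [add_zero, ContinuousLinearMap.det]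
      simp
    obtain ⟨δ, hδ, h⟩ := Metric.eventually_nhds_iff.1 (hcont.eventually (lt_mem_nhds h1))
    exact ⟨δ, hδ, fun L hL => h (by simpa using hL)⟩
  obtain ⟨δ, hδ, hdet⟩ := hdet
  -- Below `1`, the product makes `id + t • u` a homeomorphism; below `δ`, it keeps the Jacobian
  -- positive.
  obtain ⟨t₀, ht₀, ht₀1, htK⟩ : ∃ t₀ : ℝ, 0 < t₀ ∧ t₀ ≤ 1 ∧ t₀ * K < min δ 1 := by
    have hm : (0 : ℝ) < min δ 1 := by positivity
    have hm1 : min δ 1 ≤ 1 := min_le_right _ _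
    have hK : (0 : ℝ) ≤ K := K.2
    refine ⟨min δ 1 / (2 * (K + 1)), by positivity, ?_, ?_⟩
    · rw [div_le_one (by positivity)]
      linarith
    · rw [div_mul_eq_mul_div, div_lt_iff₀ (by positivity)]
      nlinarith
  have hdetc : ∀ t : ℝ, ContinuousOn (fun x => (1 + t • A x).det) B := fun t =>
    ContinuousLinearMap.continuous_det.comp_continuousOn
      (continuousOn_const.add (hAc.const_smul t))
  have hvol : ∀ t ∈ Set.Icc (0 : ℝ) t₀, ∫ x in B, (1 + t • A x).det = volume.real B := by
    intro t ht
    have htK' : t * K < min δ 1 := (mul_le_mul_of_nonneg_right ht.2 K.2).trans_lt htK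
    have htu : LipschitzWith (t.toNNReal * K) fun x => t • u x := by
      refine LipschitzWith.of_dist_le_mul fun x y => ?_
      rw [dist_smul₀, NNReal.coe_mul, Real.coe_toNNReal t ht.1, Real.norm_of_nonneg ht.1, mul_assoc]
      exact mul_le_mul_of_nonneg_left (hgL'.dist_le_mul x y) ht.1
    obtain ⟨h, hh⟩ := exists_homeomorph_id_add (by
      rw [← NNReal.coe_lt_coe, NNReal.coe_mul, Real.coe_toNNReal t ht.1]
      exact htK'.trans_le (min_le_right _ _)) htu
    have hout : ∀ x ∉ B, h x = x := fun x hx => by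
      rw [hh, hu, Set.indicator_of_notMem hx, smul_zero, add_zero]
    have hin : ∀ x ∈ B, h x = (1 - t) • x + t • r x := fun x hx => by
      rw [hh, hu, Set.indicator_of_mem hx, smul_sub, sub_smul, one_smul]
      abel
    have himage : h '' B = B := by
      apply Set.Subset.antisymm
      · rintro _ ⟨x, hx, rfl⟩
        rw [hin x hx, hB, mem_closedBall_zero_iff]
        refine (norm_add_le _ _).trans ?_
        rw [norm_smul, norm_smul, hnorm x hx, Real.norm_of_nonneg ht.1,
          Real.norm_of_nonneg (sub_nonneg.2 (ht.2.trans ht₀1))]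
        have hx' : ‖x‖ ≤ 1 := mem_closedBall_zero_iff.1 hx
        nlinarith [ht.2.trans ht₀1]
      · intro y hy
        obtain ⟨x, rfl⟩ := h.surjective y
        by_contra hx
        have hxB : x ∉ B := fun h' => hx ⟨x, h', rfl⟩
        exact hxB (hout x hxB ▸ hy)
    have hder : ∀ x ∈ B, HasFDerivWithinAt h (1 + t • A x) B x := by
      intro x hx
      have h1 : HasFDerivAt (fun x => x + t • (r x - x)) (1 + t • A x) x :=
        (hasFDerivAt_id x).add ((hgd x hx).const_smul t)
      refine h1.hasFDerivWithinAt.congr (fun y hy => ?_) ?_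
      · rw [hh, hu, Set.indicator_of_mem hy]
      · rw [hh, hu, Set.indicator_of_mem hx]
    have hpos : ∀ x ∈ B, 0 < (1 + t • A x).det := by
      intro x hx
      apply hdet
      rw [norm_smul, Real.norm_of_nonneg ht.1]
      exact (mul_le_mul_of_nonneg_left (hAK x hx) ht.1).trans_lt
        (htK'.trans_le (min_le_left _ _))
    have hcv := lintegral_abs_det_fderiv_eq_addHaar_image (volume : Measure E)
      hBc.measurableSet hder h.injective.injOn
    rw [himage] at hcv
    rw [measureReal_def, ← hcv, integral_eq_lintegral_of_nonneg_ae]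
    · congr 1
      refine setLIntegral_congr_fun hBc.measurableSet fun x hx => ?_
      simp only [abs_of_pos (hpos x hx)]
    · exact (ae_restrict_iff' hBc.measurableSet).2 (ae_of_all _ fun x hx => (hpos x hx).le)
    · exact (hdetc t).aestronglyMeasurable hBc.measurableSet
  -- interpolate
  let s := Finset.range (Module.finrank ℝ E + 1)
  let v : ℕ → ℝ := fun i => t₀ / (i + 1)
  have hv : Function.Injective v := by
    intro i j hij
    have h1 : (0 : ℝ) < i + 1 := by positivity
    have h2 : (0 : ℝ) < j + 1 := by positivity
    have h3 : t₀ / ((i : ℝ) + 1) = t₀ / (j + 1) := hij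
    rw [div_eq_div_iff h1.ne' h2.ne'] at h3
    have := mul_left_cancel₀ ht₀.ne' h3
    exact_mod_cast (add_right_cancel this).symm
  have hvI : ∀ i, v i ∈ Set.Icc 0 t₀ := fun i =>
    ⟨by positivity, div_le_self ht₀.le (by simp)⟩
  -- The integral is a polynomial in `t` of degree at most the dimension and takes one value at more
  -- nodes than that, so it has this value at `t = 1` too.
  have hdet1 : ∫ x in B, (1 + (1 : ℝ) • A x).det = volume.real B := by
    have hscard : Module.finrank ℝ E < s.card := by simp [s]
    have hL : ∀ x, (1 + (1 : ℝ) • A x).det =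
        ∑ i ∈ s, (1 + v i • A x).det * (Lagrange.basis s v i).eval 1 := fun x =>
      det_one_add_smul_eq_sum_lagrange hv.injOn hscard (A x) 1
    calc ∫ x in B, (1 + (1 : ℝ) • A x).det
        = ∫ x in B, ∑ i ∈ s, (1 + v i • A x).det * (Lagrange.basis s v i).eval 1 :=
          integral_congr_ae (ae_of_all _ hL)
      _ = ∑ i ∈ s, ∫ x in B, (1 + v i • A x).det * (Lagrange.basis s v i).eval 1 :=
          integral_finsetSum _ fun i _ => ((hdetc (v i)).integrableOn_compact hBc).mul_const _
      _ = ∑ i ∈ s, volume.real B * (Lagrange.basis s v i).eval 1 :=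
          Finset.sum_congr rfl fun i _ => by rw [integral_mul_const, hvol _ (hvI i)]
      _ = volume.real B := by
          rw [← Finset.mul_sum, ← Polynomial.eval_finsetSum,
            Lagrange.sum_basis hv.injOn (by simp [s]), Polynomial.eval_one, mul_one]
  have hzero : ∫ x in B, (1 + (1 : ℝ) • A x).det = 0 := by
    have hsphere : ∀ᵐ x ∂(volume.restrict B), x ∉ Metric.sphere (0 : E) 1 :=
      ae_restrict_of_ae (measure_eq_zero_iff_ae_notMem.1
        (Measure.addHaar_sphere_of_ne_zero _ _ one_ne_zero))
    have : ∀ᵐ x ∂(volume.restrict B), (1 + (1 : ℝ) • A x).det = 0 := by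
      filter_upwards [hsphere, ae_restrict_mem hBc.measurableSet] with x hxs hx
      have hx1 : x ∈ Metric.ball (0 : E) 1 := by
        rw [mem_ball_zero_iff]
        exact lt_of_le_of_ne (mem_closedBall_zero_iff.1 hx) fun h => hxs (by simp [h])
      have hAx : 1 + (1 : ℝ) • A x = fderiv ℝ r x := by simp [hA]
      rw [hAx]
      -- Since `‖r‖` is constant, the range of the derivative is orthogonal to `r x ≠ 0`; so the
      -- derivative is not surjective.
      have hconst : (fun y => ‖r y‖ ^ 2) =ᶠ[𝓝 x] fun _ => (1 : ℝ) := by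
        filter_upwards [Metric.isOpen_ball.mem_nhds hx1] with y hy
        rw [hnorm y (Metric.ball_subset_closedBall hy), one_pow]
      have h0 := (hrd x hx).norm_sq.unique ((hasFDerivAt_const (1 : ℝ) x).congr_of_eventuallyEq hconst)
      by_contra hne
      have hsurj : Function.Surjective (fderiv ℝ r x) :=
        (LinearMap.equivOfDetNeZero (fderiv ℝ r x : E →ₗ[ℝ] E) hne).surjective
      obtain ⟨w, hw⟩ := hsurj (r x)
      have h1 := congrArg (fun L : E →L[ℝ] ℝ => L w) h0
      simp [hw, hnorm x hx] at h1
    rw [integral_congr_ae this, integral_zero]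
  rw [hzero] at hdet1
  have : 0 < volume.real B := by
    rw [measureReal_def]
    exact ENNReal.toReal_pos (Metric.measure_closedBall_pos _ _ one_pos).ne' hBc.measure_lt_top.ne
  exact this.ne hdet1

/-! ### The Lebesgue covering theorem for the ball. -/

/-- Fewer points than an affine basis has do not span the space. -/
theorem affineSpan_image_finset_ne_top {E ι : Type*} [AddCommGroup E] [Module ℝ E]
    [FiniteDimensional ℝ E] (p : ι → E) (s : Finset ι) (hs : s.card ≤ Module.finrank ℝ E) :
    affineSpan ℝ (p '' s) ≠ ⊤ := by
  classical
  rcases s.eq_empty_or_nonempty with rfl | hne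
  · simp
  intro htop
  obtain ⟨m, hm⟩ := Nat.exists_eq_succ_of_ne_zero hne.card_pos.ne'
  have h1 := finrank_vectorSpan_image_finset_le ℝ p s hm
  rw [Finset.coe_image, ← direction_affineSpan, htop, AffineSubspace.direction_top, finrank_top] at h1
  omega

open MeasureTheory in
/-- If the unit ball had too small a covering dimension, the identity could be approximated on it
by smooth maps with null image. -/
theorem exists_contDiff_near_id_null_image {E : Type*} [NormedAddCommGroup E] [NormedSpace ℝ E]
    [FiniteDimensional ℝ E] [MeasurableSpace E] [BorelSpace E] (μ : Measure E) [μ.IsAddHaarMeasure]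
    (hE : CoveringDimLE (Metric.closedBall (0 : E) 1) (Module.finrank ℝ E - 1))
    {ε : ℝ} (hε : 0 < ε) :
    ∃ F : E → E, ContDiff ℝ 1 F ∧ (∀ x ∈ Metric.closedBall (0 : E) 1, ‖F x - x‖ ≤ ε) ∧
      μ (F '' Metric.closedBall 0 1) = 0 := by
  set B := Metric.closedBall (0 : E) 1
  obtain ⟨t, -, htfin, ht⟩ := (isCompact_closedBall (0 : E) 1).finite_cover_balls hε
  obtain ⟨𝒱, hfin, hopen, hcov, href, hord⟩ := hE.2
    ((fun c => ((↑) : B → E) ⁻¹' Metric.ball c ε) '' t) (htfin.image _)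
    (by
      rintro _ ⟨c, -, rfl⟩
      exact Metric.isOpen_ball.preimage continuous_subtype_val)
    (by
      refine Set.eq_univ_of_forall fun x => ?_
      obtain ⟨c, hc, hx⟩ := Set.mem_iUnion₂.1 (ht x.2)
      exact ⟨_, ⟨c, hc, rfl⟩, hx⟩)
  have hp : ∀ V : 𝒱, ∃ c : E, (V : Set B) ⊆ ((↑) : B → E) ⁻¹' Metric.ball c ε := by
    intro V
    obtain ⟨_, ⟨c, -, rfl⟩, h⟩ := href V V.2
    exact ⟨c, h⟩
  choose p hp using hp
  have hO : ∀ V : 𝒱, ∃ O : Set E, IsOpen O ∧ ((↑) : B → E) ⁻¹' O = V := fun V =>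
    isOpen_induced_iff.1 (hopen V V.2)
  choose O hOopen hO using hO
  have : Fintype 𝒱 := hfin.fintype
  obtain ⟨φ, hφ⟩ := SmoothPartitionOfUnity.exists_isSubordinate (modelWithCornersSelf ℝ E)
    (Metric.isClosed_closedBall (x := (0 : E)) (ε := 1)) O hOopen (by
      intro x hx
      obtain ⟨V, hV, hxV⟩ := Set.mem_sUnion.1 (hcov.symm ▸ Set.mem_univ (⟨x, hx⟩ : B))
      refine Set.mem_iUnion.2 ⟨⟨V, hV⟩, ?_⟩
      have : (⟨x, hx⟩ : B) ∈ ((↑) : B → E) ⁻¹' O ⟨V, hV⟩ := by rw [hO]; exact hxV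
      exact this)
  have hmem : ∀ (x : B) (V : 𝒱), φ V x ≠ 0 → x ∈ (V : Set B) := by
    intro x V hV
    have h1 : (x : E) ∈ O V := hφ V (subset_tsupport _ hV)
    rw [← hO V]
    exact h1
  have hsum : ∀ x ∈ B, ∑ V, φ V x = 1 := fun x hx => by
    rw [← finsum_eq_sum_of_fintype]
    exact φ.sum_eq_one hx
  refine ⟨fun x => ∑ V, φ V x • p V, ?_, ?_, ?_⟩
  · refine ContDiff.sum fun V _ => ContDiff.smul ?_ contDiff_const
    exact ((φ V).contMDiff.contDiff).of_le (by exact_mod_cast le_top)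
  · intro x hx
    rw [← mem_closedBall_iff_norm]
    refine Metric.ball_subset_closedBall ?_
    classical
    dsimp only
    rw [← Finset.sum_filter_of_ne (p := fun V => φ V x ≠ 0)
      (fun V _ h => fun h0 => h (by rw [h0, zero_smul]))]
    refine (convex_ball x ε).sum_mem (fun V _ => φ.nonneg V x) ?_ fun V hV => ?_
    · rw [Finset.sum_filter_ne_zero, hsum x hx]
    · rw [Metric.mem_ball, dist_comm]
      exact hp V (hmem ⟨x, hx⟩ V (Finset.mem_filter.1 hV).2)
  -- The order bound `d + 1` is here the dimension itself, so each value is a convex combination of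
  -- too few points to span. The image lies in finitely many proper affine subspaces.
  · have hsub : (fun x => ∑ V, φ V x • p V) '' B ⊆
        ⋃ s ∈ {s : Finset 𝒱 | s.card ≤ Module.finrank ℝ E}, (affineSpan ℝ (p '' s) : Set E) := by
      classical
      rintro _ ⟨x, hx, rfl⟩
      refine Set.mem_iUnion₂.2 ⟨Finset.univ.filter fun V => φ V x ≠ 0, ?_, ?_⟩
      · have h1 := hord ⟨x, hx⟩
        have h2 : (Finset.univ.filter fun V : 𝒱 => φ V x ≠ 0).card ≤
            {V ∈ 𝒱 | (⟨x, hx⟩ : B) ∈ V}.ncard := by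
          rw [← Set.ncard_coe_finset, ← Set.ncard_image_of_injective _ Subtype.val_injective]
          refine Set.ncard_le_ncard ?_ (hfin.subset (Set.sep_subset _ _))
          rintro _ ⟨V, hV, rfl⟩
          exact ⟨V.2, hmem ⟨x, hx⟩ V (Finset.mem_filter.1 (Finset.mem_coe.1 hV)).2⟩
        simp only [Set.mem_ofPred_eq]
        omega
      · refine convexHull_subset_affineSpan _ ?_
        dsimp only
        rw [← Finset.sum_filter_of_ne (p := fun V => φ V x ≠ 0)
          (fun V _ h => fun h0 => h (by rw [h0, zero_smul]))]
        refine (convex_convexHull ℝ _).sum_mem (fun V _ => φ.nonneg V x) ?_ fun V hV => ?_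
        · rw [Finset.sum_filter_ne_zero, hsum x hx]
        · exact subset_convexHull ℝ _ ⟨V, hV, rfl⟩
    refine measure_mono_null hsub ?_
    refine (measure_biUnion_null_iff (Set.to_countable _)).2 fun s hs => ?_
    exact Measure.addHaar_affineSubspace μ _ (affineSpan_image_finset_ne_top p s hs)

open MeasureTheory in
/-- **Lebesgue covering theorem**: the covering dimension of the unit ball of a Euclidean space is
at least the dimension of the space. -/
theorem not_coveringDimLE_closedBall {E : Type*} [NormedAddCommGroup E] [InnerProductSpace ℝ E]
    [FiniteDimensional ℝ E] :
    ¬ CoveringDimLE (Metric.closedBall (0 : E) 1) (Module.finrank ℝ E - 1) := by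
  intro hE
  borelize E
  obtain ⟨F, hF, hFid, hFnull⟩ :=
    exists_contDiff_near_id_null_image (volume : Measure E) hE (ε := 1 / 4) (by norm_num)
  obtain ⟨y, hy, hyF⟩ : ∃ y ∈ Metric.ball (0 : E) (1 / 4), y ∉ F '' Metric.closedBall 0 1 := by
    by_contra! h
    exact (Metric.measure_ball_pos volume (0 : E) (by norm_num : (0 : ℝ) < 1 / 4)).ne'
      (measure_mono_null h hFnull)
  rw [mem_ball_zero_iff] at hy
  -- `H` equals `F - y` where `‖x‖ ≤ 3 / 4`, and the identity on the unit sphere. In between, the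
  -- correction has norm at most `1 / 4 + 1 / 4 < 3 / 4`, so it cannot cancel `x`.
  let χ : ContDiffBump (0 : E) := ⟨3 / 4, 1, by norm_num, by norm_num⟩
  let H : E → E := fun x => x + χ x • (F x - y - x)
  have hH : ContDiff ℝ 1 H :=
    contDiff_id.add ((χ.contDiff (n := 1)).smul ((hF.sub contDiff_const).sub contDiff_id))
  have hH0 : ∀ x ∈ Metric.closedBall (0 : E) 1, H x ≠ 0 := by
    intro x hx h0
    by_cases hx34 : ‖x‖ ≤ 3 / 4
    · have h1 : χ x = 1 := χ.one_of_mem_closedBall (by simpa using hx34)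
      simp only [H, h1, one_smul, add_sub_cancel] at h0
      exact hyF ⟨x, hx, sub_eq_zero.1 h0⟩
    · have h1 : ‖F x - y - x‖ ≤ 1 / 2 := by
        rw [sub_right_comm]
        refine (norm_sub_le _ _).trans ?_
        linarith [hFid x hx]
      have h2 : ‖x‖ = ‖χ x • (F x - y - x)‖ := by
        rw [← norm_neg (χ x • _)]
        exact congrArg norm (eq_neg_of_add_eq_zero_left h0)
      rw [norm_smul, Real.norm_of_nonneg χ.nonneg] at h2
      have h3 := χ.le_one (x := x)
      have h4 := χ.nonneg (x := x)
      nlinarith [norm_nonneg (F x - y - x)]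
  refine not_exists_contDiff_retraction (r := fun x => ‖H x‖⁻¹ • H x) (fun x hx => ?_)
    (fun x hx => ?_) (fun x hx => ?_)
  · exact ((hH.contDiffAt.norm ℝ (hH0 x hx)).inv (norm_ne_zero_iff.2 (hH0 x hx))).smul hH.contDiffAt
  · rw [norm_smul, norm_inv, norm_norm, inv_mul_cancel₀ (norm_ne_zero_iff.2 (hH0 x hx))]
  · have : χ x = 0 := χ.zero_of_le_dist (by simp [χ, hx])
    simp [H, this, hx]

/-- The covering dimension does not increase along closed embeddings. -/
theorem CoveringDimLE.of_isClosedEmbedding {X Y : Type*} [TopologicalSpace X] [TopologicalSpace Y]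
    {d : ℤ} (hY : CoveringDimLE Y d) {j : X → Y} (hj : IsClosedEmbedding j) :
    CoveringDimLE X d := by
  refine ⟨hY.1, fun 𝒰 hfin hopen hcov => ?_⟩
  have hO : ∀ U : 𝒰, ∃ O : Set Y, IsOpen O ∧ j ⁻¹' O = U := fun U =>
    hj.isInducing.isOpen_iff.1 (hopen U U.2)
  choose O hOopen hO using hO
  have : Finite 𝒰 := hfin
  obtain ⟨𝒱, hVfin, hVopen, hVcov, hVref, hVord⟩ := hY.2 (insert (Set.range j)ᶜ (Set.range O))
    ((Set.finite_range O).insert _)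
    (by
      rintro _ (rfl | ⟨U, rfl⟩)
      exacts [hj.isClosed_range.isOpen_compl, hOopen U])
    (by
      refine Set.eq_univ_of_forall fun y => ?_
      by_cases hy : y ∈ Set.range j
      · obtain ⟨x, rfl⟩ := hy
        obtain ⟨U, hU, hxU⟩ := Set.mem_sUnion.1 (hcov.symm ▸ Set.mem_univ x)
        refine ⟨O ⟨U, hU⟩, Or.inr ⟨_, rfl⟩, ?_⟩
        rw [← Set.mem_preimage, hO]
        exact hxU
      · exact ⟨_, Or.inl rfl, hy⟩)
  -- Members of `𝒱` inside the complement of the range refine no `O U`, but their preimage is empty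
  -- and is discarded.
  refine ⟨((j ⁻¹' ·) '' 𝒱) \ {∅}, (hVfin.image _).subset Set.sdiff_subset, ?_, ?_, ?_, fun x => ?_⟩
  · rintro _ ⟨⟨V, hV, rfl⟩, -⟩
    exact (hVopen V hV).preimage hj.continuous
  · refine Set.eq_univ_of_forall fun x => ?_
    obtain ⟨V, hV, hxV⟩ := Set.mem_sUnion.1 (hVcov.symm ▸ Set.mem_univ (j x))
    exact ⟨_, ⟨⟨V, hV, rfl⟩, Set.nonempty_iff_ne_empty.1 ⟨x, hxV⟩⟩, hxV⟩
  · rintro _ ⟨⟨V, hV, rfl⟩, hne⟩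
    obtain ⟨x, hx⟩ := Set.nonempty_iff_ne_empty.2 hne
    obtain ⟨_, rfl | ⟨U, rfl⟩, hVU⟩ := hVref V hV
    · exact absurd ⟨x, rfl⟩ (hVU hx)
    · exact ⟨U, U.2, (Set.preimage_mono hVU).trans (hO U).subset⟩
  · refine le_trans ?_ (hVord (j x))
    rw [Nat.cast_le]
    have hfin' : {V ∈ 𝒱 | j x ∈ V}.Finite := hVfin.subset (Set.sep_subset _ _)
    refine (Set.ncard_le_ncard ?_ (hfin'.image (j ⁻¹' ·))).trans (Set.ncard_image_le hfin')
    rintro _ ⟨⟨⟨V, hV, rfl⟩, -⟩, hxV⟩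
    exact ⟨V, ⟨hV, hxV⟩, rfl⟩

/-! ### Moving one point off the image of the embedding. -/

/-- A self-homeomorphism fixing the complement of a set preserves that set. -/
theorem Homeomorph.mem_of_forall_notMem_eq {X : Type*} [TopologicalSpace X] (h : X ≃ₜ X) {K : Set X}
    (hK : ∀ x ∉ K, h x = x) {x : X} (hx : x ∈ K) : h x ∈ K := by
  by_contra hn
  exact hn (by rwa [h.injective (hK _ hn)])

theorem Homeomorph.symm_eq_of_forall_notMem_eq {X : Type*} [TopologicalSpace X] (h : X ≃ₜ X)
    {K : Set X} (hK : ∀ x ∉ K, h x = x) : ∀ x ∉ K, h.symm x = x := fun x hx => by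
  rw [Homeomorph.symm_apply_eq, hK x hx]

/-- A homeomorphism of the model space supported in a compact part of the target of a chart extends
by the identity. -/
theorem OpenPartialHomeomorph.exists_homeomorph_extend {M E : Type*} [TopologicalSpace M] [T2Space M]
    [TopologicalSpace E] (e : OpenPartialHomeomorph M E) (h : E ≃ₜ E) {K : Set E}
    (hK : IsCompact K) (hKe : K ⊆ e.target) (hfix : ∀ y ∉ K, h y = y) :
    ∃ H : M ≃ₜ M, (∀ x ∈ e.source, H x = e.symm (h (e x))) ∧ ∀ x ∉ e.symm '' K, H x = x := by
  classical
  let ext : (E ≃ₜ E) → M → M := fun h x => if x ∈ e.source then e.symm (h (e x)) else x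
  have hKc : IsClosed (e.symm '' K) :=
    (hK.image_of_continuousOn (e.continuousOn_symm.mono hKe)).isClosed
  have hKs : e.symm '' K ⊆ e.source := by
    rintro _ ⟨y, hy, rfl⟩
    exact e.map_target (hKe hy)
  have hmaps : ∀ h : E ≃ₜ E, (∀ y ∉ K, h y = y) → ∀ y ∈ e.target, h y ∈ e.target := by
    intro h hfix y hy
    by_cases hyK : y ∈ K
    · exact hKe (h.mem_of_forall_notMem_eq hfix hyK)
    · rwa [hfix y hyK]
  have hext : ∀ h : E ≃ₜ E, (∀ y ∉ K, h y = y) → ∀ x ∉ e.symm '' K, ext h x = x := by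
    intro h hfix x hx
    by_cases hxs : x ∈ e.source
    · have : e x ∉ K := fun hxK => hx ⟨e x, hxK, e.left_inv hxs⟩
      simp only [ext, if_pos hxs, hfix _ this, e.left_inv hxs]
    · simp only [ext, if_neg hxs]
  have hcont : ∀ h : E ≃ₜ E, (∀ y ∉ K, h y = y) → Continuous (ext h) := by
    intro h hfix
    refine continuous_iff_continuousAt.2 fun x => ?_
    by_cases hxs : x ∈ e.source
    · have heq : ext h =ᶠ[𝓝 x] fun x => e.symm (h (e x)) := by
        filter_upwards [e.open_source.mem_nhds hxs] with z hz
        simp only [ext, if_pos hz]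
      refine ContinuousAt.congr ?_ heq.symm
      have h1 : ContinuousAt (fun x => h (e x)) x :=
        h.continuous.continuousAt.comp (e.continuousAt hxs)
      exact ContinuousAt.comp (f := fun x => h (e x))
        (e.continuousAt_symm (hmaps h hfix _ (e.map_source hxs))) h1
    -- The image of `K` is compact, hence closed in `M`, so the extension is the identity near every
    -- point outside the chart.
    · have heq : ext h =ᶠ[𝓝 x] id := by
        filter_upwards [hKc.isOpen_compl.mem_nhds fun hx => hxs (hKs hx)] with z hz
        exact hext h hfix z hz
      exact continuousAt_id.congr heq.symm
  have hinv : ∀ h : E ≃ₜ E, (∀ y ∉ K, h y = y) → ∀ x, ext h.symm (ext h x) = x := by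
    intro h hfix x
    by_cases hxs : x ∈ e.source
    · have h1 := hmaps h hfix _ (e.map_source hxs)
      simp only [ext, if_pos hxs, if_pos (e.map_target h1), e.right_inv h1, h.symm_apply_apply,
        e.left_inv hxs]
    · simp only [ext, if_neg hxs]
  have hfix' := h.symm_eq_of_forall_notMem_eq hfix
  exact ⟨⟨⟨ext h, ext h.symm, hinv h hfix, hinv h.symm hfix'⟩, hcont h hfix, hcont h.symm hfix'⟩,
    fun x hx => if_pos hx, hext h hfix⟩

/-- The center of a ball can be moved to any point of the ball by a homeomorphism supported in it. -/
theorem exists_homeomorph_move_center {E : Type*} [NormedAddCommGroup E] [NormedSpace ℝ E]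
    [CompleteSpace E] {c q : E} {r : ℝ} (hq : dist q c < r) :
    ∃ h : E ≃ₜ E, h c = q ∧ ∀ x ∉ Metric.closedBall c r, h x = x := by
  have hr : 0 < r := dist_nonneg.trans_lt hq
  -- A tent function of height one at `c` times the displacement: its Lipschitz constant `dist q c /
  -- r` is less than one.
  let u : E → E := fun x => max (1 - dist x c / r) 0 • (q - c)
  have hu : LipschitzWith (dist q c / r).toNNReal u := by
    refine LipschitzWith.of_dist_le_mul fun x y => ?_
    rw [Real.coe_toNNReal _ (by positivity), dist_eq_norm, ← sub_smul, norm_smul, Real.norm_eq_abs,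
      ← dist_eq_norm q c]
    have h1 := abs_max_sub_max_le_abs (1 - dist x c / r) (1 - dist y c / r) 0
    have h2 : |(1 - dist x c / r) - (1 - dist y c / r)| ≤ dist x y / r := by
      rw [sub_sub_sub_cancel_left, ← sub_div, abs_div, abs_of_pos hr, abs_sub_comm]
      gcongr
      exact abs_dist_sub_le x y c
    calc _ ≤ dist x y / r * dist q c := by gcongr; exact h1.trans h2
      _ = _ := by ring
  obtain ⟨h, hh⟩ := exists_homeomorph_id_add (by
    rw [← NNReal.coe_lt_coe, Real.coe_toNNReal _ (by positivity), NNReal.coe_one, div_lt_one hr]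
    exact hq) hu
  refine ⟨h, by simp [hh, u], fun x hx => ?_⟩
  have : 1 - dist x c / r ≤ 0 := by
    rw [sub_nonpos, one_le_div hr]
    exact (not_le.1 hx).le
  simp [hh, u, max_eq_right this]

/-- An embedded space of covering dimension less than `n` contains no `n`-dimensional ball. -/
theorem exists_notMem_range_of_coveringDimLE {n : ℕ} {M A : Type*} [TopologicalSpace M] [T2Space M]
    [TopologicalSpace A] (hA : CoveringDimLE A ((n : ℤ) - 1)) {f : A → M} (hf : IsEmbedding f)
    (e : OpenPartialHomeomorph M (EuclideanSpace ℝ (Fin n))) {c : EuclideanSpace ℝ (Fin n)} {r : ℝ}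
    (hr : 0 < r) (hc : Metric.closedBall c r ⊆ e.target) :
    ∃ q ∈ Metric.closedBall c r, e.symm q ∉ Set.range f := by
  by_contra! H
  have hmem : ∀ z : Metric.closedBall (0 : EuclideanSpace ℝ (Fin n)) 1,
      c + r • (z : EuclideanSpace ℝ (Fin n)) ∈ Metric.closedBall c r := by
    intro z
    have hz : ‖(z : EuclideanSpace ℝ (Fin n))‖ ≤ 1 := mem_closedBall_zero_iff.1 z.2
    rw [mem_closedBall_iff_norm, add_sub_cancel_left, norm_smul, Real.norm_of_nonneg hr.le]
    exact mul_le_of_le_one_right hr.le hz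
  choose j hj using fun z => H _ (hmem z)
  have hcont : Continuous j := by
    rw [hf.isInducing.continuous_iff]
    have : f ∘ j = fun z : Metric.closedBall (0 : EuclideanSpace ℝ (Fin n)) 1 =>
        e.symm (c + r • (z : EuclideanSpace ℝ (Fin n))) := funext hj
    rw [this]
    exact e.continuousOn_symm.comp_continuous (by fun_prop) fun z => hc (hmem z)
  have hinj : Function.Injective j := by
    intro z w hzw
    have h1 := (hj z).symm.trans ((congrArg f hzw).trans (hj w))
    have h2 := e.symm.injOn (hc (hmem z)) (hc (hmem w)) h1
    exact Subtype.ext (smul_right_injective _ hr.ne' (add_left_cancel h2))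
  -- A continuous injection of the compact ball into the Hausdorff space `A` is a closed embedding.
  have := hf.t2Space
  have : CompactSpace (Metric.closedBall (0 : EuclideanSpace ℝ (Fin n)) 1) :=
    isCompact_iff_compactSpace.1 (isCompact_closedBall _ _)
  refine not_coveringDimLE_closedBall (E := EuclideanSpace ℝ (Fin n)) ?_
  rw [finrank_euclideanSpace_fin]
  exact hA.of_isClosedEmbedding (hcont.isClosedEmbedding hinj)

/-- An interior point can be moved off an embedded space of covering dimension less than `n` by a
homeomorphism with small support. -/
theorem exists_homeomorph_push_off {n : ℕ} {M A : Type*} [TopologicalSpace M] [T2Space M]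
    [TopologicalSpace A] (hA : CoveringDimLE A ((n : ℤ) - 1)) {f : A → M} (hf : IsEmbedding f)
    {p : M} (hp : p ∈ manifoldInterior n M) {W : Set M} (hW : W ∈ 𝓝 p) :
    ∃ φ : M ≃ₜ M, φ p ∉ Set.range f ∧ ∀ x ∉ W ∩ manifoldInterior n M, φ x = x := by
  obtain ⟨e, he⟩ := hp
  have hpre : e.target ∩ e.symm ⁻¹' W ∈ 𝓝 (e p) := by
    refine Filter.inter_mem (e.open_target.mem_nhds (e.map_source he)) ?_
    refine (e.continuousAt_symm (e.map_source he)).preimage_mem_nhds ?_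
    rwa [e.left_inv he]
  obtain ⟨r, hr, hrs⟩ := Metric.nhds_basis_closedBall.mem_iff.1 hpre
  obtain ⟨q, hq, hqf⟩ := exists_notMem_range_of_coveringDimLE hA hf e (half_pos hr)
    ((Metric.closedBall_subset_closedBall (half_le_self hr.le)).trans
      (hrs.trans Set.inter_subset_left))
  obtain ⟨h, hhc, hfix⟩ := exists_homeomorph_move_center
    ((Metric.mem_closedBall.1 hq).trans_lt (half_lt_self hr))
  obtain ⟨φ, hφ, hφfix⟩ := e.exists_homeomorph_extend h (isCompact_closedBall (e p) r)
    (hrs.trans Set.inter_subset_left) hfix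
  refine ⟨φ, by rwa [hφ p he, hhc], fun x hx => hφfix x ?_⟩
  rintro ⟨y, hy, rfl⟩
  exact hx ⟨(hrs hy).2, e, e.map_target (hrs hy).1⟩

/-! ### Infinite compositions and the conclusion. -/

/-- Two sequences of mutually inverse homeomorphisms of a compact metric space that both converge
geometrically have a homeomorphism as limit. -/
theorem exists_homeomorph_tendsto {M : Type*} [MetricSpace M] [CompactSpace M] (h : ℕ → M ≃ₜ M)
    (h₁ : ∀ k x, dist (h k x) (h (k + 1) x) ≤ (1 / 2) ^ k)
    (h₂ : ∀ k x, dist ((h k).symm x) ((h (k + 1)).symm x) ≤ (1 / 2) ^ k) :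
    ∃ H : M ≃ₜ M, ∀ x, Filter.Tendsto (fun k => h k x) Filter.atTop (𝓝 (H x)) := by
  have key : ∀ F : ℕ → C(M, M), (∀ k x, dist (F k x) (F (k + 1) x) ≤ (1 / 2) ^ k) →
      ∃ G : C(M, M), Filter.Tendsto F Filter.atTop (𝓝 G) := by
    intro F hF
    refine cauchySeq_tendsto_of_complete
      (cauchySeq_of_le_geometric (1 / 2) 1 (by norm_num) fun k => ?_)
    rw [one_mul, ContinuousMap.dist_le (by positivity)]
    exact hF k
  obtain ⟨G, hG⟩ := key (fun k => (h k : C(M, M))) h₁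
  obtain ⟨K, hK⟩ := key (fun k => ((h k).symm : C(M, M))) h₂
  have hev : ∀ {F : ℕ → C(M, M)} {L : C(M, M)}, Filter.Tendsto F Filter.atTop (𝓝 L) →
      ∀ x, Filter.Tendsto (fun k => F k x) Filter.atTop (𝓝 (L x)) := fun hF x =>
    ((continuous_eval_const x).tendsto _).comp hF
  -- Uniform convergence lets both the map and its argument vary, so the two limits are again
  -- mutually inverse.
  have hcomp : ∀ {F F' : ℕ → C(M, M)} {L L' : C(M, M)}, Filter.Tendsto F Filter.atTop (𝓝 L) →
      Filter.Tendsto F' Filter.atTop (𝓝 L') → (∀ k x, F k (F' k x) = x) → ∀ x, L (L' x) = x := by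
    intro F F' L L' hF hF' hid x
    have h1 : Filter.Tendsto (fun k => F k (F' k x)) Filter.atTop (𝓝 (L (L' x))) :=
      (continuous_eval.tendsto (L, L' x)).comp (hF.prodMk_nhds (hev hF' x))
    simp only [hid] at h1
    exact tendsto_nhds_unique h1 tendsto_const_nhds
  exact ⟨⟨⟨G, K, hcomp hK hG fun k x => (h k).symm_apply_apply x,
    hcomp hG hK fun k x => (h k).apply_symm_apply x⟩, G.continuous, K.continuous⟩, hev hG⟩

/-- If single points of `I` can be moved off `X` by homeomorphisms with small support in `I`, then
so can all the points of a sequence, simultaneously. -/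
theorem exists_homeomorph_forall_notMem {M : Type*} [MetricSpace M] [CompactSpace M] {X I : Set M}
    (hpush : ∀ p ∈ I, ∀ W ∈ 𝓝 p, ∃ φ : M ≃ₜ M, φ p ∉ X ∧ ∀ x ∉ W ∩ I, φ x = x)
    (t : ℕ → M) (ht : ∀ k, t k ∈ I) :
    ∃ h : M ≃ₜ M, (∀ k, h (t k) ∉ X) ∧ ∀ x ∉ I, h x = x := by
  have step : ∀ (h : {h : M ≃ₜ M // ∀ x ∉ I, h x = x}) (k : ℕ),
      ∃ h' : {h : M ≃ₜ M // ∀ x ∉ I, h x = x}, h'.1 (t k) ∉ X ∧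
        (∀ j < k, h.1 (t j) ∉ X → h'.1 (t j) = h.1 (t j)) ∧
        (∀ x, dist (h.1 x) (h'.1 x) ≤ (1 / 2) ^ k) ∧
        ∀ x, dist (h.1.symm x) (h'.1.symm x) ≤ (1 / 2) ^ k := by
    rintro ⟨h, hfix⟩ k
    by_cases hX : h (t k) ∈ X
    swap
    · exact ⟨⟨h, hfix⟩, hX, fun _ _ _ => rfl, by simp, by simp⟩
    have hε : (0 : ℝ) < (1 / 2) ^ k := by positivity
    -- A displacement below `δ` by `φ` changes the inverse of the composition by less than `(1 / 2)
    -- ^ k`.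
    obtain ⟨δ, hδ, huc⟩ := Metric.uniformContinuous_iff.1
      (CompactSpace.uniformContinuous_of_continuous h.symm.continuous) _ hε
    set η := min δ ((1 / 2) ^ k) with hη
    have hη0 : 0 < η := lt_min hδ hε
    -- The points already placed off `X`; the support of `φ` avoids them.
    set S : Set M := {y ∈ (fun j => h (t j)) '' Set.Iio k | y ∉ X}
    have hS : S.Finite := ((Set.finite_Iio k).image _).subset (Set.sep_subset _ _)
    have hW : Metric.ball (h (t k)) (η / 2) ∩ Sᶜ ∈ 𝓝 (h (t k)) :=
      Filter.inter_mem (Metric.ball_mem_nhds _ (half_pos hη0))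
        (hS.isClosed.compl_mem_nhds fun hmem => hmem.2 hX)
    obtain ⟨φ, hφX, hφ⟩ := hpush _ (h.mem_of_forall_notMem_eq hfix (ht k)) _ hW
    have hclose : ∀ y, dist y (φ y) < η := by
      intro y
      by_cases hy : y ∈ Metric.ball (h (t k)) (η / 2) ∩ Sᶜ ∩ I
      · have h1 := Metric.mem_ball.1 hy.1.1
        have h2 := Metric.mem_ball.1 (φ.mem_of_forall_notMem_eq hφ hy).1.1
        linarith [dist_triangle_right y (φ y) (h (t k))]
      · rwa [hφ y hy, dist_self]
    refine ⟨⟨h.trans φ, fun x hx => ?_⟩, hφX, fun j hj hjX => ?_, fun x => ?_, fun x => ?_⟩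
    · rw [Homeomorph.trans_apply, hfix x hx, hφ x fun h' => hx h'.2]
    · exact hφ _ fun h' => h'.1.2 ⟨⟨j, hj, rfl⟩, hjX⟩
    · exact ((hclose (h x)).trans_le (min_le_right _ _)).le
    · refine (huc ?_).le
      have h1 := hclose (φ.symm x)
      rw [φ.apply_symm_apply, dist_comm] at h1
      exact h1.trans_le (min_le_left _ _)
  choose F hF₁ hF₂ hF₃ hF₄ using step
  let s : ℕ → {h : M ≃ₜ M // ∀ x ∉ I, h x = x} :=
    fun k => Nat.rec ⟨Homeomorph.refl M, fun _ _ => rfl⟩ (fun k h => F h k) k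
  obtain ⟨H, hH⟩ := exists_homeomorph_tendsto (fun k => (s k).1) (fun k => hF₃ (s k) k)
    (fun k => hF₄ (s k) k)
  refine ⟨H, fun j => ?_, fun x hx => ?_⟩
  -- As `X` need not be closed, avoiding it at each stage would not pass to the limit; instead the
  -- image of `t j` is constant from stage `j + 1` on.
  · have hconst : ∀ m, (s (j + 1 + m)).1 (t j) = (s (j + 1)).1 (t j) := by
      intro m
      induction m with
      | zero => rfl
      | succ m ih =>
        rw [← ih]
        exact hF₂ (s (j + 1 + m)) (j + 1 + m) j (by omega) (by rw [ih]; exact hF₁ (s j) j)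
    have h1 := (hH (t j)).comp (Filter.tendsto_add_atTop_nat (j + 1))
    have h2 : H (t j) = (s (j + 1)).1 (t j) :=
      tendsto_nhds_unique h1 (tendsto_const_nhds.congr fun m => by
        rw [← hconst m, Function.comp_apply, add_comm])
    rw [h2]
    exact hF₁ (s j) j
  · exact tendsto_nhds_unique (hH x) (tendsto_const_nhds.congr fun k => ((s k).2 x hx).symm)

theorem theoremA4 (n : ℕ) {M : Type*} [TopologicalSpace M] [CompactSpace M]
    (hM : IsTopManifoldWithBoundary n M)
    {A : Type*} [TopologicalSpace A] (hA : CoveringDimLE A ((n : ℤ) - 1))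
    (f : A → M) (hf : IsEmbedding f)
    (T : Set M) (hT : T.Countable) (hTint : T ⊆ manifoldInterior n M) :
    ∃ g : A → M, IsEmbedding g ∧ (∀ a : A, g a ∉ T) ∧
      g ⁻¹' manifoldBoundary n M = f ⁻¹' manifoldBoundary n M ∧
      ∀ a : A, f a ∈ manifoldBoundary n M → g a = f a := by
  rcases T.eq_empty_or_nonempty with rfl | hne
  · exact ⟨f, hf, fun _ h => h, rfl, fun _ _ => rfl⟩
  obtain ⟨t, rfl⟩ := hT.exists_eq_range hne
  have := hM.t2
  have := hM.secondCountable
  let _ : MetricSpace M := TopologicalSpace.metrizableSpaceMetric M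
  obtain ⟨h, hX, hfix⟩ := exists_homeomorph_forall_notMem
    (fun p hp W hW => exists_homeomorph_push_off hA hf hp hW) t fun k => hTint ⟨k, rfl⟩
  have hfix' := h.symm_eq_of_forall_notMem_eq hfix
  -- A value of `h.symm ∘ f` in `T` would be a point of `T` that `h` sends into the range of `f`.
  refine ⟨h.symm ∘ f, h.symm.isEmbedding.comp hf, ?_, ?_, fun a ha => hfix' _ ha⟩
  · rintro a ⟨k, hk⟩
    exact hX k ⟨a, by rw [hk, Function.comp_apply, h.apply_symm_apply]⟩
  · ext a
    constructor
    · intro ha hfa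
      exact ha (h.symm.mem_of_forall_notMem_eq hfix' hfa)
    · intro ha
      rw [Set.mem_preimage, Function.comp_apply, hfix' _ ha]
      exact ha
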